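/- Let $G$ be a countable group and let $K$ be an uncountable algebraically closed field. Let $X$ be an algebraic group over $K$ (a group object in the category of $K$-schemes whose underlying $K$-scheme is reduced and of finite type; not necessarily connected, affine or commutative), and let $A = X(K)$ be its set of $K$-points. Let $\tau \colon A^G \to A^G$ be an algebraic group cellular automaton, that is, there are a finite subset $M \subset G$ and a homomorphism of algebraic groups $f \colon X^M \to X$ over $K$, where $X^M$ is the fibered product over $K$ of copies of $X$ indexed by $M$, inducing $\mu \colon A^M \to A$ on $K$-points, such that $$\tau(c)(g) = \mu\big((g^{-1}c)\vert_M\big) \quad \text{for all } c \in A^G,\ g \in G,$$ where $(gc)(h) = c(g^{-1}h)$. Call two configurations in $A^G$ asymptotic if they agree outside a finite subset of $G$, and suppose that $\tau$ is post-surjective: for all $x, y \in A^G$ with $y$ asymptotic to $\tau(x)$ there exists $z \in A^G$ asymptotic to $x$ such that $\tau(z) = y$. Then there exists a finite subset $E \subset G$ with the following property: for all $x, y \in A^G$ such that $y\vert_{G \setminus \{1_G\}} = \tau(x)\vert_{G \setminus \{1_G\}}$, there exists $x' \in A^G$ such that $\tau(x') = y$ and $x'\vert_{G \setminus E} = x\vert_{G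 \setminus E}$. -/

import Mathlib

open CategoryTheory CategoryTheory.Limits CategoryTheory.MonoidalCategory AlgebraicGeometry

universe u v w

/-! ### Cellular automata over a group `G` with alphabet `A` -/

section CellularAutomata

variable {G : Type v} [Group G] {A : Type w}

/-- The Bernoulli shift on configurations: `(g c)(h) = c (g⁻¹ h)`. -/
def bernoulliShift (g : G) (c : G → A) : G → A := fun h => c (g⁻¹ * h)

/-- The map `τ` is the cellular automaton with memory set `M` and local defining map `μ`:
`τ(c)(g) = μ ((g⁻¹ c)|_M)` for all `c` and `g`. -/
def IsCellularAutomatonWith (τ : (G → A) → (G → A)) (M : Finset G) (μ : (M → A) → A) : Prop :=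
  ∀ (c : G → A) (g : G), τ c g = μ (fun m : M => bernoulliShift g⁻¹ c m)

/-- Two configurations are asymptotic if they agree outside some finite subset of `G`. -/
def Asymptotic (c d : G → A) : Prop :=
  ∃ E : Finset G, ∀ g, g ∉ E → c g = d g

/-- Post-surjectivity: if `y` is asymptotic to `τ(x)`, then `y = τ(z)` for some `z` asymptotic
to `x`. -/
def PostSurjective (τ : (G → A) → (G → A)) : Prop :=
  ∀ x y : G → A, Asymptotic y (τ x) → ∃ z : G → A, Asymptotic z x ∧ τ z = y

end CellularAutomata

/-! ### Algebraic groups and their rational points -/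

section AlgebraicGroups

variable {K : Type u} [Field K]

/-- An algebraic variety over `K`: a reduced `K`-scheme of finite type. -/
class IsAlgebraicVariety (X : Over (Spec (.of K))) : Prop where
  isReduced : IsReduced X.left
  locallyOfFiniteType : LocallyOfFiniteType X.hom
  quasiCompact : QuasiCompact X.hom

/-- The set `X(K)` of `K`-points of a `K`-group scheme `X`, that is, of morphisms of `K`-schemes
`Spec K ⟶ X` (the monoidal unit of `Over (Spec K)` is `Spec K` itself). -/
abbrev RationalPoints (X : Grp (Over (Spec (.of K)))) : Type u :=
  𝟙_ (Over (Spec (.of K))) ⟶ X.X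

/-- The fibered power `X^ι` over `K`, with its product structure of `K`-group scheme. -/
noncomputable abbrev groupPower (X : Grp (Over (Spec (.of K)))) (ι : Type v) [Finite ι] :
    Grp (Over (Spec (.of K))) :=
  ∏ᶜ fun _ : ι => X

/-- The underlying `K`-scheme of `X^ι` is the fibered product over `K` of copies of `X`. -/
noncomputable def groupPowerIso (X : Grp (Over (Spec (.of K)))) (ι : Type v) [Finite ι] :
    (groupPower X ι).X ≅ ∏ᶜ fun _ : ι => X.X :=
  PreservesProduct.iso (Grp.forget (Over (Spec (.of K)))) fun _ : ι => X

theorem groupPowerIso_hom_π (X : Grp (Over (Spec (.of K)))) {ι : Type v} [Finite ι] (i : ι) :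
    (groupPowerIso X ι).hom ≫ Pi.π (fun _ : ι => X.X) i =
      (Pi.π (fun _ : ι => X) i).hom.hom :=
  piComparison_comp_π (Grp.forget (Over (Spec (.of K)))) (fun _ : ι => X) i

/-- The identification of `X(K)^ι` with `X^ι(K)`: the point of `X^ι` with coordinates `a`. -/
noncomputable def pointOfCoords (X : Grp (Over (Spec (.of K)))) {ι : Type v} [Finite ι]
    (a : ι → RationalPoints X) : RationalPoints (groupPower X ι) :=
  Pi.lift a ≫ (groupPowerIso X ι).inv

/-- The coordinates of `pointOfCoords X a` are given by `a`. -/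
theorem pointOfCoords_π (X : Grp (Over (Spec (.of K)))) {ι : Type v} [Finite ι]
    (a : ι → RationalPoints X) (i : ι) :
    pointOfCoords X a ≫ (Pi.π (fun _ : ι => X) i).hom.hom = a i := by
  rw [pointOfCoords, Category.assoc, ← groupPowerIso_hom_π, Iso.inv_hom_id_assoc, Pi.lift_π]

/-- A point of `X^ι` is determined by its coordinates. -/
theorem eq_pointOfCoords (X : Grp (Over (Spec (.of K)))) {ι : Type v} [Finite ι]
    (p : RationalPoints (groupPower X ι)) :
    p = pointOfCoords X fun i => p ≫ (Pi.π (fun _ : ι => X) i).hom.hom := by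
  rw [pointOfCoords, Iso.eq_comp_inv]
  refine Pi.hom_ext _ _ fun i => ?_
  rw [Category.assoc, groupPowerIso_hom_π, Pi.lift_π]

/-- The map `X(K)^ι → X(K)` induced on `K`-points by a homomorphism of `K`-group schemes
`f : X^ι ⟶ X`. -/
noncomputable def inducedMap (X : Grp (Over (Spec (.of K)))) {ι : Type v} [Finite ι]
    (f : groupPower X ι ⟶ X) (a : ι → RationalPoints X) : RationalPoints X :=
  pointOfCoords X a ≫ f.hom.hom

/-- The set of algebraic group cellular automata over `(G, X, K)`: the cellular automata
`τ : X(K)^G → X(K)^G` admitting a finite memory set `M` whose local defining map is induced by a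
homomorphism of algebraic groups `X^M ⟶ X`. -/
def CAalgr (G : Type v) [Group G] (X : Grp (Over (Spec (.of K)))) :
    Set ((G → RationalPoints X) → (G → RationalPoints X)) :=
  {τ | ∃ (M : Finset G) (f : groupPower X M ⟶ X), IsCellularAutomatonWith τ M (inducedMap X f)}

end AlgebraicGroups

/-! Since `f` is a homomorphism, so is `τ`. It therefore suffices to find a finite `E` such that
every configuration supported at `1` has a preimage supported in `E`: multiplying `x` by such a
preimage corrects `τ x` at `1` and changes `x` only on `E`. Post-surjectivity over the trivial
configuration gives a finite support for each `a ∈ X(K)` separately. For fixed `E`, the values `a`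
attained are the images of the rational points of a finite type scheme `W E ⟶ X`, whose range is
constructible by Chevalley. There are countably many `E`, and together these ranges contain all
rational points. As `K` is uncountable, a point of `X` outside all of them would yield a rational
point outside all of them, so they cover `X`. Compactness of the constructible topology leaves
finitely many `E`, and their union works (`exists_finset_forall_exists_comp_eq`,
`exists_uniform_support`). -/

/-! ### Nullstellensatz with countably many inequations. -/

section CountableNullstellensatz

open Cardinal

variable {K : Type u} [Field K]

/-- A field extension of countable dimension over an uncountable field is algebraic. -/
theorem isAlgebraic_of_rank_le_aleph0 [Uncountable K] {L : Type u} [Field L] [Algebra K L]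
    (h : Module.rank K L ≤ ℵ₀) : Algebra.IsAlgebraic K L := by
  by_contra hL
  rw [← Algebra.transcendental_iff_not_isAlgebraic] at hL
  -- For `t` transcendental the elements `1/(t - c)`, `c ∈ K`, are independent; so the rank is the
  -- cardinality of `L`, at least that of `K`.
  rw [Algebra.Transcendental.rank_eq_cardinalMk] at h
  exact absurd ((mk_le_of_injective (algebraMap K L).injective).trans h) (by simp)

/-- Over an uncountable algebraically closed field, every nontrivial algebra of countable
dimension has a rational point. -/
theorem nonempty_algHom_of_rank_le_aleph0 [IsAlgClosed K] [Uncountable K] {B : Type u} [CommRing B]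
    [Algebra K B] [Nontrivial B] (h : Module.rank K B ≤ ℵ₀) : Nonempty (B →ₐ[K] K) := by
  obtain ⟨m, hm⟩ := Ideal.exists_maximal B
  let := Ideal.Quotient.field m
  have : Module.rank K (B ⧸ m) ≤ ℵ₀ :=
    (LinearMap.rank_le_of_surjective (Ideal.Quotient.mkₐ K m).toLinearMap
      (Ideal.Quotient.mkₐ_surjective K m)).trans h
  have := isAlgebraic_of_rank_le_aleph0 this
  exact ⟨(IsAlgClosed.lift (M := K) (R := K) (S := B ⧸ m)).comp (Ideal.Quotient.mkₐ K m)⟩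

/-- Polynomials in countably many variables have a countable basis of monomials. -/
theorem rank_adjoin_le_aleph0 {L : Type u} [CommRing L] [Algebra K L] {s : Set L}
    (hs : s.Countable) : Module.rank K (Algebra.adjoin K s) ≤ ℵ₀ := by
  have := hs.to_subtype
  rw [Algebra.adjoin_eq_range]
  refine (rank_range_le (MvPolynomial.aeval ((↑) : s → L)).toLinearMap).trans ?_
  rw [MvPolynomial.rank_eq]
  exact Cardinal.mk_le_aleph0

/-- A countable form of the Nullstellensatz: a prime of a finitely generated algebra over an
uncountable algebraically closed field specializes to a rational point avoiding countably many
prescribed functions that do not vanish at that prime. -/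
theorem exists_algHom_forall_ne_zero [IsAlgClosed K] [Uncountable K] {R : Type u} [CommRing R]
    [Algebra K R] [Algebra.FiniteType K R] (p : Ideal R) [p.IsPrime] {ι : Type v} [Countable ι]
    (f : ι → R) (hf : ∀ i, f i ∉ p) :
    ∃ φ : R →ₐ[K] K, (∀ r ∈ p, φ r = 0) ∧ ∀ i, φ (f i) ≠ 0 := by
  let L := FractionRing (R ⧸ p)
  let π : R →ₐ[K] L := (IsScalarTower.toAlgHom K (R ⧸ p) L).comp (Ideal.Quotient.mkₐ K p)
  have hπ : ∀ r, π r = 0 ↔ r ∈ p := fun r => by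
    simp [π, Ideal.Quotient.eq_zero_iff_mem]
  obtain ⟨s, hs⟩ := Algebra.FiniteType.out (R := K) (A := R)
  -- Inverting every `f i` keeps the algebra countably generated, and a `K`-point of it cannot kill
  -- any `f i`.
  let t : Set L := π '' s ∪ Set.range fun i => (π (f i))⁻¹
  have ht : t.Countable := (s.countable_toSet.image π).union (Set.countable_range _)
  have hR : ∀ r, π r ∈ Algebra.adjoin K t := fun r => by
    have : r ∈ Algebra.adjoin K (s : Set R) := hs ▸ Algebra.mem_top
    have : π r ∈ (Algebra.adjoin K (s : Set R)).map π := ⟨r, this, rfl⟩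
    rw [AlgHom.map_adjoin] at this
    exact Algebra.adjoin_mono Set.subset_union_left this
  obtain ⟨ψ⟩ := nonempty_algHom_of_rank_le_aleph0 (rank_adjoin_le_aleph0 (K := K) ht)
  refine ⟨ψ.comp (π.codRestrict _ hR), fun r hr => ?_, fun i => ?_⟩
  · have : π.codRestrict _ hR r = 0 := Subtype.ext ((hπ r).mpr hr)
    simp [this]
  · refine IsUnit.ne_zero ((IsUnit.of_mul_eq_one ⟨(π (f i))⁻¹,
      Algebra.subset_adjoin (Or.inr ⟨i, rfl⟩)⟩ (Subtype.ext ?_)).map ψ)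
    exact mul_inv_cancel₀ fun h => hf i ((hπ _).mp h)

end CountableNullstellensatz

/-! ### Compactness in the constructible topology. -/

section ConstructibleTopology

open Topology

/-- Constructible sets of a Noetherian space are open in the constructible topology. -/
theorem Topology.IsConstructible.isOpen_constructibleTopology {X : Type u} [TopologicalSpace X]
    [TopologicalSpace.NoetherianSpace X] {s : Set X} (hs : Topology.IsConstructible s) :
    IsOpen[constructibleTopology X] s := by
  -- Openness alone does not pass to complements, so the induction carries clopenness.
  suffices h : IsOpen[constructibleTopology X] s ∧ IsOpen[constructibleTopology X] sᶜ from h.1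
  induction hs using Topology.IsConstructible.empty_union_induction with
  | open_retrocompact U hU _ =>
    have hc : IsCompact U := TopologicalSpace.NoetherianSpace.isCompact U
    refine ⟨hc.isOpen_constructibleTopology_of_isOpen hU, ?_⟩
    exact IsCompact.isOpen_constructibleTopology_of_isClosed (by rwa [compl_compl])
      hU.isClosed_compl
  | union s _ t _ hs ht =>
    rw [Set.compl_union]
    exact ⟨@IsOpen.union _ _ _ (constructibleTopology X) hs.1 ht.1,
      @IsOpen.inter _ (constructibleTopology X) _ _ hs.2 ht.2⟩
  | compl s _ hs => exact ⟨hs.2, by rw [compl_compl]; exact hs.1⟩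

/-- A cover of a Noetherian sober space by constructible sets has a finite subcover. -/
theorem exists_finset_iUnion_eq_univ_of_isConstructible {X : Type u} [TopologicalSpace X]
    [TopologicalSpace.NoetherianSpace X] [QuasiSober X]
    {ι : Type w} (D : ι → Set X) (hD : ∀ i, Topology.IsConstructible (D i))
    (hcov : ⋃ i, D i = Set.univ) : ∃ s : Finset ι, ⋃ i ∈ s, D i = Set.univ := by
  obtain ⟨s, hs⟩ := isCompact_univ.elim_finite_subcover
    (fun i => (WithTopology.ofTopology ⁻¹' D i : Set (WithConstructibleTopology X)))
    (fun i => WithConstructibleTopology.isOpen_iff.mpr (hD i).isOpen_constructibleTopology)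
    (by rw [← Set.preimage_iUnion, hcov, Set.preimage_univ])
  refine ⟨s, Set.eq_univ_of_forall fun x => ?_⟩
  simpa using hs (Set.mem_univ (WithTopology.toTopology _ x))

end ConstructibleTopology

/-! ### Constructible sets and rational points. -/

section RationalPoints

variable {K : Type u} [Field K]

/-- The underlying point of a rational point of a `K`-scheme. -/
noncomputable def pointOf {X : Over (Spec (.of K))} (a : 𝟙_ (Over (Spec (.of K))) ⟶ X) : X.left :=
  a.left (IsLocalRing.closedPoint K)

/-- The property of `K`-schemes of being of finite type. -/
def ofFiniteType (K : Type u) [Field K] : ObjectProperty (Over (Spec (.of K))) :=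
  fun X => LocallyOfFiniteType X.hom ∧ QuasiCompact X.hom

theorem ofFiniteType.isNoetherian {X : Over (Spec (.of K))} (hX : ofFiniteType K X) :
    IsNoetherian X.left := by
  have := hX.1
  have := hX.2
  have := LocallyOfFiniteType.isLocallyNoetherian X.hom
  have : CompactSpace X.left := QuasiCompact.compactSpace_of_compactSpace X.hom
  constructor

theorem ofFiniteType.locallyOfFiniteType_left {X Y : Over (Spec (.of K))} (hX : ofFiniteType K X)
    (f : X ⟶ Y) : LocallyOfFiniteType f.left := by
  have := hX.1
  rw [← Over.w f] at this
  exact locallyOfFiniteType_of_comp f.left Y.hom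

/-- Chevalley's theorem. -/
theorem ofFiniteType.isConstructible_range {X Y : Over (Spec (.of K))} (hX : ofFiniteType K X)
    (hY : ofFiniteType K Y) (f : X ⟶ Y) : Topology.IsConstructible (Set.range f.left) := by
  have := hX.isNoetherian
  have := hY.isNoetherian
  have := hX.locallyOfFiniteType_left f
  rw [← Set.image_univ]
  exact f.left.isConstructible_image .univ

variable [IsAlgClosed K]

/-- A rational point whose underlying point lies in the image of a morphism lifts along it. -/
theorem exists_lift_of_pointOf_mem_range {W X : Over (Spec (.of K))} (hW : ofFiniteType K W)
    (f : W ⟶ X) (a : 𝟙_ (Over (Spec (.of K))) ⟶ X) (ha : pointOf a ∈ Set.range f.left) :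
    ∃ p : 𝟙_ (Over (Spec (.of K))) ⟶ W, p ≫ f = a := by
  obtain ⟨w, hw⟩ := ha
  have := hW.locallyOfFiniteType_left f
  obtain ⟨z, -, -⟩ := Scheme.Pullback.exists_preimage_pullback (f := f.left) (g := a.left) w
    (IsLocalRing.closedPoint K) hw
  let q : pullback f.left a.left ⟶ Spec (.of K) := pullback.snd f.left a.left
  -- The fibre over `a` is nonempty and locally of finite type over `K`, so it has a closed point,
  -- which is rational because `K` is algebraically closed.
  have : JacobsonSpace (pullback f.left a.left : Scheme) := LocallyOfFiniteType.jacobsonSpace q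
  obtain ⟨y, hy⟩ : (closedPoints (pullback f.left a.left : Scheme)).Nonempty := by
    rw [← closure_nonempty_iff, closure_closedPoints]
    exact ⟨z, trivial⟩
  let r : Spec (.of K) ⟶ pullback f.left a.left := pointOfClosedPoint q y hy
  have hr : r ≫ pullback.snd f.left a.left = 𝟙 _ := pointOfClosedPoint_comp q y hy
  have hrf : (r ≫ pullback.fst _ _) ≫ f.left = a.left := by
    rw [Category.assoc, pullback.condition, reassoc_of% hr]
  refine ⟨Over.homMk (r ≫ pullback.fst _ _) ?_, ?_⟩
  · rw [← Over.w f, ← Category.assoc, hrf]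
    exact Over.w a
  · ext1
    exact hrf

variable [Uncountable K]

/-- Countably many constructible sets having a common point have a common rational point. -/
theorem exists_pointOf_mem_of_isConstructible {X : Over (Spec (.of K))} (hX : ofFiniteType K X)
    {ι : Type w} [Countable ι] (C : ι → Set X.left) (hC : ∀ i, Topology.IsConstructible (C i))
    (x : X.left) (hx : ∀ i, x ∈ C i) :
    ∃ a : 𝟙_ (Over (Spec (.of K))) ⟶ X, ∀ i, pointOf a ∈ C i := by
  have := hX.1
  obtain ⟨U, hU, hxU, -⟩ := exists_isAffineOpen_mem_and_subset (TopologicalSpace.Opens.mem_top x)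
  let j := hU.fromSpec
  let ρ := Spec.preimage (j ≫ X.hom)
  have hρ : Spec.map ρ = j ≫ X.hom := Spec.map_preimage _
  have hft : ρ.hom.FiniteType := by
    rw [← HasRingHomProperty.Spec_iff (P := @LocallyOfFiniteType), hρ]
    infer_instance
  let := ρ.hom.toAlgebra
  have : Algebra.FiniteType K Γ(X.left, U) := hft
  obtain ⟨p, hp⟩ : ∃ p : PrimeSpectrum Γ(X.left, U), j p = x := ⟨hU.primeIdealOf ⟨x, hxU⟩, hU.fromSpec_primeIdealOf _⟩
  -- Inside `U`, each `C i` contains `V(p) ∩ D(r)` for some `r ∉ p`; a rational point of `V(p)` off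
  -- countably many hypersurfaces then suffices.
  have key : ∀ i, ∃ r ∉ p.asIdeal, ∀ q : PrimeSpectrum Γ(X.left, U), p.asIdeal ≤ q.asIdeal →
      r ∉ q.asIdeal → j q ∈ C i := fun i => by
    have hCi : Topology.IsConstructible (j ⁻¹' C i) :=
      (hC i).preimage_of_isOpenEmbedding j.isOpenEmbedding
    obtain ⟨S, hS⟩ := PrimeSpectrum.exists_constructibleSetData_iff.mpr hCi
    have hpi : p ∈ S.toSet := hS.ge (show j p ∈ C i from hp ▸ hx i)
    obtain ⟨B, hB, hpB⟩ := Set.mem_iUnion₂.mp hpi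
    refine ⟨B.f, fun h => hpB.2 (by simpa [PrimeSpectrum.mem_zeroLocus] using h), fun q hq hr => ?_⟩
    exact hS.le <| Set.mem_iUnion₂.mpr ⟨B, hB, Set.Subset.trans hpB.1 hq, fun h => hr (by simpa [PrimeSpectrum.mem_zeroLocus] using h)⟩
  choose r hr hr' using key
  obtain ⟨φ, hφ, hφ'⟩ := exists_algHom_forall_ne_zero (K := K) p.asIdeal r hr
  let s : Spec (.of K) ⟶ Spec Γ(X.left, U) := Spec.map (CommRingCat.ofHom φ.toRingHom)
  have hs : (s ≫ j) ≫ X.hom = 𝟙 _ := by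
    rw [Category.assoc, ← hρ, ← Spec.map_comp, ← Spec.map_id]
    congr 1
    ext y
    exact φ.commutes y
  refine ⟨Over.homMk (s ≫ j) hs, fun i => ?_⟩
  change j (s (IsLocalRing.closedPoint K)) ∈ C i
  have hmem : ∀ y, y ∈ (s (IsLocalRing.closedPoint K)).asIdeal ↔ φ y = 0 := fun y => by
    change φ y ∈ IsLocalRing.maximalIdeal K ↔ _
    simp
  exact hr' i _ (fun y hy => (hmem y).mpr (hφ y hy)) fun h => hφ' i ((hmem _).mp h)

/-- A countable family of morphisms of finite type `K`-schemes that is jointly surjective on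
rational points has a finite subfamily with the same property. -/
theorem exists_finset_forall_exists_comp_eq {X : Over (Spec (.of K))} (hX : ofFiniteType K X)
    {ι : Type w} [Countable ι] (W : ι → Over (Spec (.of K))) (hW : ∀ i, ofFiniteType K (W i))
    (f : ∀ i, W i ⟶ X)
    (h : ∀ a : 𝟙_ (Over (Spec (.of K))) ⟶ X, ∃ i, ∃ p : 𝟙_ (Over (Spec (.of K))) ⟶ W i,
      p ≫ f i = a) :
    ∃ s : Finset ι, ∀ a : 𝟙_ (Over (Spec (.of K))) ⟶ X, ∃ i ∈ s,
      ∃ p : 𝟙_ (Over (Spec (.of K))) ⟶ W i, p ≫ f i = a := by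
  have := hX.isNoetherian
  have hD := fun i => (hW i).isConstructible_range hX (f i)
  obtain ⟨s, hs⟩ := exists_finset_iUnion_eq_univ_of_isConstructible
    (fun i => Set.range (f i).left) hD <| by
      refine Set.eq_univ_of_forall fun x => ?_
      by_contra hx
      simp only [Set.mem_iUnion, not_exists] at hx
      obtain ⟨a, ha⟩ := exists_pointOf_mem_of_isConstructible hX
        (fun i => (Set.range (f i).left)ᶜ) (fun i => (hD i).compl) x hx
      obtain ⟨i, p, rfl⟩ := h a
      exact ha i ⟨pointOf p, rfl⟩
  refine ⟨s, fun a => ?_⟩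
  obtain ⟨i, hi, hai⟩ := Set.mem_iUnion₂.mp (hs.ge (Set.mem_univ (pointOf a)))
  exact ⟨i, hi, exists_lift_of_pointOf_mem_range (hW i) (f i) a hai⟩

end RationalPoints

/-! ### Finite products and fibres of finite type schemes. -/

section FiniteTypeLimits

variable {K : Type u} [Field K]

instance : (ofFiniteType K).IsClosedUnderIsomorphisms where
  of_iso {X Y} e hX := by
    have := hX.1
    have := hX.2
    have : IsIso e.inv.left := inferInstanceAs (IsIso ((Over.forget _).map e.inv))
    constructor
    · rw [← Over.w e.inv]
      infer_instance
    · rw [← Over.w e.inv]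
      infer_instance

theorem ofFiniteType_unit : ofFiniteType K (𝟙_ (Over (Spec (.of K)))) := by
  exact ⟨inferInstanceAs (LocallyOfFiniteType (𝟙 (Spec (.of K)))),
    inferInstanceAs (QuasiCompact (𝟙 (Spec (.of K))))⟩

theorem ofFiniteType.tensorObj {X Y : Over (Spec (.of K))} (hX : ofFiniteType K X)
    (hY : ofFiniteType K Y) : ofFiniteType K (X ⊗ Y) := by
  have := hX.1
  have := hX.2
  have := hY.1
  have := hY.2
  constructor
  · rw [Over.tensorObj_hom]
    infer_instance
  · rw [Over.tensorObj_hom]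
    infer_instance

instance : (ofFiniteType K).IsClosedUnderBinaryProducts where
  limitsOfShape_le := by
    rintro X ⟨p⟩
    refine (ofFiniteType K).prop_of_iso
      (p.isLimit.conePointsIsoOfNatIso
        (CartesianMonoidalCategory.tensorProductIsBinaryProduct (p.diag.obj ⟨.left⟩)
          (p.diag.obj ⟨.right⟩)) (diagramIsoPair p.diag)).symm
      ((p.prop_diag_obj _).tensorObj (p.prop_diag_obj _))

instance : (ofFiniteType K).IsClosedUnderLimitsOfShape (Discrete.{0} PEmpty) where
  limitsOfShape_le := by
    rintro X ⟨p⟩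
    exact (ofFiniteType K).prop_of_iso
      (p.isLimit.conePointsIsoOfNatIso CartesianMonoidalCategory.isTerminalTensorUnit
        (Functor.uniqueFromEmpty _)).symm ofFiniteType_unit

instance : (ofFiniteType K).IsClosedUnderFiniteProducts := .mk'

/-- The fibre of a morphism of finite type `K`-schemes over a rational point. -/
theorem exists_fiber {P Y : Over (Spec (.of K))} (hP : ofFiniteType K P) (α : P ⟶ Y)
    (b : 𝟙_ (Over (Spec (.of K))) ⟶ Y) :
    ∃ (W : Over (Spec (.of K))) (i : W ⟶ P), ofFiniteType K W ∧
      ∀ p : 𝟙_ (Over (Spec (.of K))) ⟶ P, p ≫ α = b ↔ ∃ q, q ≫ i = p := by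
  have := hP.1
  have := hP.2
  have := ofFiniteType_unit.locallyOfFiniteType_left b
  have := (ofFiniteType_unit (K := K)).isNoetherian
  have : QuasiCompact b.left := quasiCompact_of_noetherianSpace_source _
  have hpb := ((IsPullback.of_hasPullback α b).map (Over.forget _)).flip
  have : LocallyOfFiniteType (pullback.fst α b).left :=
    MorphismProperty.of_isPullback (P := @LocallyOfFiniteType) hpb ‹_›
  have : QuasiCompact (pullback.fst α b).left :=
    MorphismProperty.of_isPullback (P := @QuasiCompact) hpb ‹_›
  refine ⟨pullback α b, pullback.fst α b, ⟨?_, ?_⟩, fun p => ⟨fun h => ?_, ?_⟩⟩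
  · rw [← Over.w (pullback.fst α b)]
    infer_instance
  · rw [← Over.w (pullback.fst α b)]
    infer_instance
  · exact ⟨pullback.lift p (𝟙 _) (by simpa using h), pullback.lift_fst _ _ _⟩
  · rintro ⟨q, rfl⟩
    rw [Category.assoc, pullback.condition, ← Category.assoc,
      CartesianMonoidalCategory.toUnit_unique (q ≫ pullback.snd α b) (𝟙 _), Category.id_comp]

end FiniteTypeLimits

/-! ### Multiplicativity of the automaton. -/

section Homomorphisms

open scoped MonObj

variable {K : Type u} [Field K] (X : Grp (Over (Spec (.of K)))) {J : Type v} [Finite J]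

theorem pointOfCoords_mul (a b : J → RationalPoints X) :
    pointOfCoords X (a * b) = pointOfCoords X a * pointOfCoords X b := by
  rw [eq_pointOfCoords X (pointOfCoords X a * pointOfCoords X b)]
  congr 1
  funext i
  rw [MonObj.mul_comp, pointOfCoords_π, pointOfCoords_π]
  rfl

theorem inducedMap_mul (f : groupPower X J ⟶ X) (a b : J → RationalPoints X) :
    inducedMap X f (a * b) = inducedMap X f a * inducedMap X f b := by
  rw [inducedMap, pointOfCoords_mul, MonObj.mul_comp]
  rfl

variable {X}

/-- An algebraic group cellular automaton is a group homomorphism. -/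
theorem CAalgr.map_mul {G : Type v} [Group G]
    {τ : (G → RationalPoints X) → (G → RationalPoints X)} (hτ : τ ∈ CAalgr G X)
    (c d : G → RationalPoints X) : τ (c * d) = τ c * τ d := by
  obtain ⟨M, f, hf⟩ := hτ
  funext g
  rw [Pi.mul_apply, hf, hf, hf, ← inducedMap_mul]
  rfl

end Homomorphisms

/-! ### Uniform finite supports and the conclusion. -/

section FiniteSupport

open scoped MonObj

open scoped Classical in
/-- The extension by the neutral element of a configuration on a finite set. -/
noncomputable def extendByOne {G : Type v} {K : Type u} [Field K]
    (X : Grp (Over (Spec (.of K)))) (E : Finset G) (z : E → RationalPoints X) :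
    G → RationalPoints X :=
  fun g => if h : g ∈ E then z ⟨g, h⟩ else 1

variable {G : Type v} {K : Type u} [Field K] {X : Grp (Over (Spec (.of K)))}

theorem extendByOne_restrict {E : Finset G} {z : G → RationalPoints X} (hz : ∀ g ∉ E, z g = 1) :
    extendByOne X E (fun e => z e) = z := by
  funext g
  by_cases h : g ∈ E
  · simp [extendByOne, h]
  · simp [extendByOne, h, hz g h]

variable [Group G]

open scoped Classical in
/-- The value at `g` of an algebraic group cellular automaton on the configurations supported in a
finite set `E` is a morphism `X^E ⟶ X` of `K`-schemes. -/
noncomputable def evalMorphism {M : Finset G} (f : groupPower X M ⟶ X) (E : Finset G) (g : G) :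
    (∏ᶜ fun _ : E => X.X) ⟶ X.X :=
  Pi.lift (fun m : M => if h : g * m ∈ E then Pi.π (fun _ : E => X.X) ⟨g * m, h⟩ else 1) ≫
    (groupPowerIso X M).inv ≫ f.hom.hom

theorem lift_comp_evalMorphism {τ : (G → RationalPoints X) → (G → RationalPoints X)} {M : Finset G}
    {f : groupPower X M ⟶ X} (hf : IsCellularAutomatonWith τ M (inducedMap X f)) (E : Finset G)
    (g : G) (z : E → RationalPoints X) :
    Pi.lift z ≫ evalMorphism f E g = τ (extendByOne X E z) g := by
  rw [hf, inducedMap, pointOfCoords, evalMorphism, ← Category.assoc]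
  simp only [← Category.assoc]
  congr 2
  refine Pi.hom_ext _ _ fun m => ?_
  rw [Category.assoc, Pi.lift_π, Pi.lift_π, bernoulliShift, inv_inv, extendByOne]
  split_ifs
  · exact Pi.lift_π _ _
  · exact MonObj.comp_one _

open scoped Classical in
/-- For a post-surjective algebraic group cellular automaton, configurations supported at the
neutral element have finitely supported preimages. -/
theorem PostSurjective.exists_finite_support {τ : (G → RationalPoints X) → (G → RationalPoints X)}
    (hτ : τ ∈ CAalgr G X) (hpost : PostSurjective τ) (a : RationalPoints X) :
    ∃ (E : Finset G) (z : G → RationalPoints X), (∀ g ∉ E, z g = 1) ∧ τ z = Pi.mulSingle 1 a := by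
  have hone : τ 1 = 1 := by simpa using CAalgr.map_mul hτ 1 1
  obtain ⟨z, ⟨E, hE⟩, hz⟩ := hpost 1 (Pi.mulSingle 1 a) ⟨{1}, fun g hg => by
    rw [hone, Pi.mulSingle_eq_of_ne (by simpa using hg)]; rfl⟩
  exact ⟨E, z, hE, hz⟩

variable [Countable G] [IsAlgClosed K] [Uncountable K]

open scoped Classical in
/-- If every configuration supported at the neutral element has a finitely supported preimage, then
these preimages can be supported in a common finite set. -/
theorem exists_uniform_support [IsAlgebraicVariety X.X]
    {τ : (G → RationalPoints X) → (G → RationalPoints X)} (hτ : τ ∈ CAalgr G X)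
    (h : ∀ a : RationalPoints X, ∃ (E : Finset G) (z : G → RationalPoints X),
      (∀ g ∉ E, z g = 1) ∧ τ z = Pi.mulSingle 1 a) :
    ∃ E : Finset G, ∀ a : RationalPoints X, ∃ z : G → RationalPoints X,
      (∀ g ∉ E, z g = 1) ∧ τ z = Pi.mulSingle 1 a := by
  have hone : τ 1 = 1 := by simpa using CAalgr.map_mul hτ 1 1
  obtain ⟨M, f, hf⟩ := hτ
  have hX : ofFiniteType K X.X :=
    ⟨IsAlgebraicVariety.locallyOfFiniteType, IsAlgebraicVariety.quasiCompact⟩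
  -- `τ z g` only sees `z` on `gM`, which meets `E` only if `g ∈ E M⁻¹`. So triviality of `τ z` off
  -- `1` is a finite set of conditions; `1` is erased because the value there is free.
  let F : Finset G → Finset G := fun E =>
    ((E ×ˢ M).image fun x => x.1 * x.2⁻¹).erase 1
  have hF : ∀ (E : Finset G) (z : G → RationalPoints X), (∀ g ∉ E, z g = 1) →
      ∀ g, g ≠ 1 → g ∉ F E → τ z g = 1 := fun E z hz g hg1 hg => by
    rw [show (1 : RationalPoints X) = τ 1 g by rw [hone]; rfl, hf, hf]
    congr 1
    funext m
    rw [bernoulliShift, inv_inv]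
    refine hz _ fun hE => hg ?_
    simp only [F, Finset.mem_erase, Finset.mem_image, Finset.mem_product]
    exact ⟨hg1, (g * m, m), ⟨hE, m.2⟩, by simp⟩
  -- Rational points of `W E` give the configurations on `E` whose image is trivial off `1`.
  choose W i hW hi using fun E : Finset G =>
    exists_fiber ((ofFiniteType K).prop_product fun _ : E => hX)
      (Pi.lift fun g : F E => evalMorphism f E g) (Pi.lift fun _ => (1 : RationalPoints X))
  have hsupp : ∀ (E : Finset G) (a : RationalPoints X),
      (∃ q : 𝟙_ (Over (Spec (.of K))) ⟶ W E, q ≫ i E ≫ evalMorphism f E 1 = a) ↔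
        ∃ z : G → RationalPoints X, (∀ g ∉ E, z g = 1) ∧ τ z = Pi.mulSingle 1 a := fun E a => by
    constructor
    · rintro ⟨q, rfl⟩
      let z : E → RationalPoints X := fun e => (q ≫ i E) ≫ Pi.π _ e
      have hz : Pi.lift z = q ≫ i E := Pi.hom_ext _ _ fun e => Pi.lift_π _ _
      have hz1 : ∀ g ∉ E, extendByOne X E z g = 1 := fun g hg => dif_neg hg
      refine ⟨extendByOne X E z, hz1, funext fun g => ?_⟩
      by_cases hg1 : g = 1
      · subst hg1
        rw [← lift_comp_evalMorphism hf, hz, Pi.mulSingle_eq_same, Category.assoc]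
      · rw [Pi.mulSingle_eq_of_ne hg1]
        by_cases hg : g ∈ F E
        · have := congr($((hi E _).mpr ⟨q, rfl⟩) ≫ Pi.π _ (⟨g, hg⟩ : F E))
          rwa [Category.assoc, Pi.lift_π, Pi.lift_π, ← hz, lift_comp_evalMorphism hf] at this
        · exact hF E _ hz1 g hg1 hg
    · rintro ⟨z, hz, hzτ⟩
      obtain ⟨q, hq⟩ := (hi E (Pi.lift fun e : E => z e)).mp <| Pi.hom_ext _ _ fun g => by
        rw [Category.assoc, Pi.lift_π, Pi.lift_π, lift_comp_evalMorphism hf,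
          extendByOne_restrict hz, hzτ, Pi.mulSingle_eq_of_ne (Finset.ne_of_mem_erase g.2)]
      refine ⟨q, ?_⟩
      rw [← Category.assoc, hq, lift_comp_evalMorphism hf, extendByOne_restrict hz, hzτ,
        Pi.mulSingle_eq_same]
  obtain ⟨s, hs⟩ := exists_finset_forall_exists_comp_eq hX W hW
    (fun E => i E ≫ evalMorphism f E 1) fun a => by
      obtain ⟨E, hE⟩ := h a
      exact ⟨E, (hsupp E a).mpr hE⟩
  refine ⟨s.biUnion id, fun a => ?_⟩
  obtain ⟨E, hEs, hE⟩ := hs a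
  obtain ⟨z, hz, hzτ⟩ := (hsupp E a).mp hE
  exact ⟨z, fun g hg => hz g fun hgE => hg (Finset.mem_biUnion.mpr ⟨E, hEs, hgE⟩), hzτ⟩

/-- A post-surjective algebraic group cellular automaton lifts changes at the neutral element
uniformly. -/
theorem PostSurjective.exists_uniform_lift [IsAlgebraicVariety X.X]
    {τ : (G → RationalPoints X) → (G → RationalPoints X)}
    (hτ : τ ∈ CAalgr G X) (hpost : PostSurjective τ) :
    ∃ E : Finset G, ∀ x y : G → RationalPoints X,
      (∀ g : G, g ≠ 1 → y g = τ x g) →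
        ∃ x' : G → RationalPoints X, τ x' = y ∧ ∀ g : G, g ∉ E → x' g = x g := by
  classical
  obtain ⟨E, hE⟩ := exists_uniform_support hτ (hpost.exists_finite_support hτ)
  refine ⟨E, fun x y hxy => ?_⟩
  -- `X` need not be commutative: the correction multiplies `τ x 1` on the right.
  obtain ⟨z, hz, hzτ⟩ := hE ((τ x 1)⁻¹ * y 1)
  refine ⟨x * z, funext fun g => ?_, fun g hg => ?_⟩
  · rw [CAalgr.map_mul hτ, hzτ, Pi.mul_apply]
    by_cases hg : g = 1
    · subst hg
      rw [Pi.mulSingle_eq_same, mul_inv_cancel_left]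
    · rw [Pi.mulSingle_eq_of_ne hg, mul_one, hxy g hg]
  · rw [Pi.mul_apply, hz g hg, mul_one]

end FiniteSupport

theorem mainTheorem6 {G : Type v} [Group G] [Countable G]
    {K : Type u} [Field K] [IsAlgClosed K] [Uncountable K]
    (X : Grp (Over (Spec (.of K)))) [IsAlgebraicVariety X.X]
    (τ : (G → RationalPoints X) → (G → RationalPoints X))
    (hτ : τ ∈ CAalgr G X) (hpost : PostSurjective τ) :
    ∃ E : Finset G, ∀ x y : G → RationalPoints X,
      (∀ g : G, g ≠ 1 → y g = τ x g) →
        ∃ x' : G → RationalPoints X, τ x' = y ∧ ∀ g : G, g ∉ E → x' g = x g :=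
  hpost.exists_uniform_lift hτ
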